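/- **Theorem 4.8.** Let $m\ge 1$ and let $H, G_1,\dots,G_m$ be real Hilbert spaces. Let $\Gamma_0(E)$ denote the class of proper lower semicontinuous convex functions $E\to(-\infty,+\infty]$. Let $f:H\to\mathbb R$ be convex and differentiable with $L$-Lipschitz continuous gradient, $L\in(0,+\infty)$; let $g\in\Gamma_0(H)$, let $h_i\in\Gamma_0(G_i)$, and let $B_i:H\to G_i$ be bounded linear operators, $i=1,\dots,m$. Consider the problem $$\min_{x\in H}\; f(x)+g(x)+\sum_{i=1}^m h_i(B_ix), \qquad (1.1)$$ and assume that its optimality inclusion is solvable, i.e. that there is some $z\in H$ with $$0\in\nabla f(z)+\partial g(z)+\sum_{i=1}^m B_i^*\,\partial h_i(B_iz).$$ Let $\gamma\in(0,2/L)$ and let $\sigma,\tau>0$ satisfy $\sigma\tau\sum_{i=1}^m\|B_i\|^2<1$ (that is, $\sigma\tau<1/\sum_{i=1}^m\|B_i\|^2$, with no restriction if all $B_i=0$). For arbitrary $x^0\in H$ and $y_i^0\in G_i$, let $\bar x^0=x^0$ and let the sequences $u^k,\bar x^k,y_i^k,x^k$ be generated by the primal-dual forward-backward splitting algorithm (Algorithm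 4.4) with one inner iteration per outer iteration and with $\bar x^k=x^k$ for all $k$: for $k=0,1,2,\dots$, $$u^k=x^k-\gamma\nabla f(x^k),$$ $$\bar x^{k+1}=\mathrm{prox}_{\frac{\tau\gamma}{1+\tau}g}\left(\frac{\bar x^{k}-\tau\sum_{i=1}^m B_i^*y_i^{k}+\tau u^k}{1+\tau}\right),$$ $$y_i^{k+1}=\gamma\,\mathrm{prox}_{\frac{\sigma}{\gamma}h_i^*}\left(\frac1\gamma\bigl(y_i^{k}+\sigma B_i(2\bar x^{k+1}-\bar x^{k})\bigr)\right),\quad i=1,\dots,m,$$ $$x^{k+1}=\bar x^{k+1},$$ where $\mathrm{prox}_{\lambda\varphi}(u)=\arg\min_x\{\tfrac12\|x-u\|^2+\lambda\varphi(x)\}$ and $h_i^*(y)=\sup_x\{\langle x,y\rangle-h_i(x)\}$. Then $(x^k)$ converges weakly in $H$ to a solution (global minimizer, with finite optimal value) of (1.1). -/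

import Mathlib

open Filter Topology

/-- The class `Γ₀(E)`: proper lower semicontinuous convex functions `E → (-∞, +∞]`. -/
structure IsGammaZero {E : Type*} [NormedAddCommGroup E] [InnerProductSpace ℝ E]
    (φ : E → EReal) : Prop where
  ne_bot : ∀ x, φ x ≠ ⊥
  exists_ne_top : ∃ x, φ x ≠ ⊤
  lsc : LowerSemicontinuous φ
  convex : ∀ (x y : E) (a b : ℝ), 0 < a → 0 < b → a + b = 1 →
    φ (a • x + b • y) ≤ (a : EReal) * φ x + (b : EReal) * φ y

/-- The Fenchel conjugate `φ*(y) = sup_x (⟪x, y⟫ - φ x)`. -/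
noncomputable def fenchelConj {E : Type*} [NormedAddCommGroup E] [InnerProductSpace ℝ E]
    (φ : E → EReal) (y : E) : EReal :=
  ⨆ x : E, ((inner ℝ x y : ℝ) : EReal) - φ x

/-- The (convex) subdifferential of `φ` at `x`. -/
def subdiff {E : Type*} [NormedAddCommGroup E] [InnerProductSpace ℝ E]
    (φ : E → EReal) (x : E) : Set E :=
  {v | ∀ z : E, φ x + ((inner ℝ (z - x) v : ℝ) : EReal) ≤ φ z}

/-- `p = prox_{lam φ}(u)`, i.e. `p` is a minimizer over `x` of `½ ‖x - u‖² + lam φ(x)`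
(for `φ ∈ Γ₀(E)`, `E` complete and `lam > 0` there is exactly one). -/
def IsProx {E : Type*} [NormedAddCommGroup E] [InnerProductSpace ℝ E]
    (lam : ℝ) (φ : E → EReal) (u p : E) : Prop :=
  IsMinOn (fun x : E => (((1 / 2 : ℝ) * ‖x - u‖ ^ 2 : ℝ) : EReal) + (lam : EReal) * φ x)
    Set.univ p

section Problem

variable {H : Type*} [NormedAddCommGroup H] [InnerProductSpace ℝ H] [CompleteSpace H]
  {m : ℕ} {G : Fin m → Type*} [∀ i, NormedAddCommGroup (G i)]
  [∀ i, InnerProductSpace ℝ (G i)] [∀ i, CompleteSpace (G i)]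

/-- The objective `f(x) + g(x) + ∑ i, h_i(B_i x)`. -/
noncomputable def objective (f : H → ℝ) (g : H → EReal) (h : ∀ i, G i → EReal)
    (B : ∀ i, H →L[ℝ] G i) (x : H) : EReal :=
  (f x : EReal) + g x + ∑ i, h i (B i x)

/-- `x` solves `min f(x) + g(x) + ∑ i, h_i(B_i x)`: it is a global minimizer of the objective,
with a finite value there. -/
def IsSolution (f : H → ℝ) (g : H → EReal) (h : ∀ i, G i → EReal)
    (B : ∀ i, H →L[ℝ] G i) (x : H) : Prop :=
  objective f g h B x ≠ ⊤ ∧ IsMinOn (objective f g h B) Set.univ x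

/-- The optimality inclusion `0 ∈ ∇f(x) + ∂g(x) + ∑ i, B_i^* ∂h_i(B_i x)`. -/
def SatisfiesInclusion (f : H → ℝ) (g : H → EReal) (h : ∀ i, G i → EReal)
    (B : ∀ i, H →L[ℝ] G i) (x : H) : Prop :=
  ∃ a ∈ subdiff g x, ∃ b : ∀ i, G i, (∀ i, b i ∈ subdiff (h i) (B i x)) ∧
    gradient f x + a + ∑ i, (ContinuousLinearMap.adjoint (B i)) (b i) = 0

/-- The sequences `u`, `xbar`, `y`, `x` are generated by the (unweighted) primal-dual
forward-backward splitting algorithm, with a single inner iteration per outer iteration and with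
the inner iterates indexed by the outer counter (`j_k = k`). -/
structure IsPrimalDualFB (f : H → ℝ) (g : H → EReal) (h : ∀ i, G i → EReal)
    (B : ∀ i, H →L[ℝ] G i) (γ σ τ : ℝ)
    (u xbar : ℕ → H) (y : ℕ → ∀ i, G i) (x : ℕ → H) : Prop where
  /-- `u^k = x^k - γ ∇f(x^k)` -/
  forward_step : ∀ k, u k = x k - γ • gradient f (x k)
  /-- `xbar^{k+1} = prox_{(τγ/(1+τ)) g} ((xbar^k - τ ∑ i, B_i^* y_i^k + τ u^k) / (1+τ))` -/
  primal_step : ∀ k, IsProx (τ * γ / (1 + τ)) g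
    ((1 / (1 + τ)) •
      (xbar k - τ • ∑ i, (ContinuousLinearMap.adjoint (B i)) (y k i) + τ • u k))
    (xbar (k + 1))
  /-- `y_i^{k+1} = γ prox_{(σ/γ) h_i^*} ((y_i^k + σ B_i (2 xbar^{k+1} - xbar^k)) / γ)` -/
  dual_step : ∀ k i, ∃ p : G i,
    IsProx (σ / γ) (fenchelConj (h i))
      ((1 / γ) • (y k i + σ • B i ((2 : ℝ) • xbar (k + 1) - xbar k))) p ∧
    y (k + 1) i = γ • p
  /-- `x^{k+1}` is the output of the inner loop -/
  update : ∀ k, x (k + 1) = xbar (k + 1)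

end Problem

/-! ### Convex functions with Lipschitz gradient. -/

section Smooth

variable {E : Type*} [NormedAddCommGroup E] [InnerProductSpace ℝ E] [CompleteSpace E]

/-! Rescale the dual variables to v = y / γ and stack the B i into one operator T. On the Hilbert
product of H and the G i, the optimality inclusion becomes 0 ∈ ∂Ψ w + C w + S w, where Ψ (x, v) = g
x + ∑ h_i* (v_i), C (x, v) = (∇f x, 0) and S (x, v) = (T* v, -T x) is skew. The optimality
conditions of the two prox steps together say P (w k - w (k+1)) - C (w k) - S (w (k+1)) ∈ ∂Ψ (w
(k+1)), with P (x, v) = (r x - T* v, t⁻¹ v - T x), r = (1 + τ) / (τ γ), t = σ / γ. This is the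
Condat–Vũ view: a forward-backward iteration in the metric P.

By Baillon–Haddad ∇f is cocoercive, and the step-size conditions give L / 2 + t ∑ ‖B i‖² < r. Hence
P has room to absorb the error of evaluating C at the old iterate (`exists_primalDualMetric_slack`).
So the P-distance to every zero decreases, the steps vanish and C (w k) converges strongly; weak
cluster points are zeros, and Opial's argument leaves only one (`forwardBackward_weakTendsto`).
Fenchel–Moreau (`IsGammaZero.mem_subdiff_of_fenchelConj`) carries a zero back to the original
inclusion, which implies global minimality by convexity. -/

theorem hasDerivAt_comp_segment {f : E → ℝ} (hf : Differentiable ℝ f) (x d : E) (t : ℝ) :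
    HasDerivAt (fun r : ℝ => f (x + r • d)) (inner ℝ (gradient f (x + t • d)) d) t := by
  have h1 : HasFDerivAt f (InnerProductSpace.toDual ℝ E (gradient f (x + t • d))) (x + t • d) :=
    ((hf (x + t • d)).hasGradientAt).hasFDerivAt
  have h2 : HasDerivAt (fun r : ℝ => x + r • d) d t := by
    simpa using ((hasDerivAt_id t).smul_const d).const_add x
  exact h1.comp_hasDerivAt t h2

theorem ConvexOn.inner_gradient_le {f : E → ℝ} (hc : ConvexOn ℝ Set.univ f)
    (hf : Differentiable ℝ f) (x y : E) :
    f x + inner ℝ (gradient f x) (y - x) ≤ f y := by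
  have hd := hasDerivAt_comp_segment hf x (y - x) 0
  have hφ : ConvexOn ℝ Set.univ (fun r : ℝ => f (x + r • (y - x))) := by
    have := hc.comp_affineMap (AffineMap.lineMap x y : ℝ →ᵃ[ℝ] E)
    have heq : (fun r : ℝ => f (x + r • (y - x))) = f ∘ (AffineMap.lineMap x y : ℝ →ᵃ[ℝ] E) := by
      funext r
      simp [AffineMap.lineMap_apply, add_comm]
    rw [heq]
    exact this
  have := hφ.le_slope_of_hasDerivAt (Set.mem_univ 0) (Set.mem_univ 1) one_pos hd
  simp [slope_def_field, -inner_gradient_left] at this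
  linarith

/-- Descent lemma: along the segment, f minus its quadratic majorant has nonpositive derivative. -/
theorem le_add_inner_gradient_add_sq {f : E → ℝ} {L : ℝ} (hf : Differentiable ℝ f)
    (hlip : ∀ z w : E, ‖gradient f z - gradient f w‖ ≤ L * ‖z - w‖) (x d : E) :
    f (x + d) ≤ f x + inner ℝ (gradient f x) d + L / 2 * ‖d‖ ^ 2 := by
  let ψ : ℝ → ℝ := fun r => f (x + r • d) - r * inner ℝ (gradient f x) d - L / 2 * ‖d‖ ^ 2 * r ^ 2
  have hψ : ∀ t, HasDerivAt ψ
      (inner ℝ (gradient f (x + t • d)) d - inner ℝ (gradient f x) d - L * ‖d‖ ^ 2 * t) t := by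
    intro t
    have := ((hasDerivAt_comp_segment hf x d t).sub
      ((hasDerivAt_id t).mul_const (inner ℝ (gradient f x) d))).sub
      ((hasDerivAt_pow 2 t).const_mul (L / 2 * ‖d‖ ^ 2))
    refine HasDerivAt.congr_deriv this ?_
    simp only [one_mul, Nat.cast_ofNat, Nat.add_one_sub_one, pow_one]
    ring
  have hanti : AntitoneOn ψ (Set.Icc 0 1) := by
    refine antitoneOn_of_deriv_nonpos (convex_Icc 0 1)
      (fun t _ => (hψ t).continuousAt.continuousWithinAt)
      (fun t _ => (hψ t).differentiableAt.differentiableWithinAt) ?_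
    intro t ht
    rw [interior_Icc] at ht
    rw [(hψ t).deriv, ← inner_sub_left]
    have h1 := real_inner_le_norm (gradient f (x + t • d) - gradient f x) d
    have h2 := hlip (x + t • d) x
    rw [add_sub_cancel_left, norm_smul, Real.norm_eq_abs, abs_of_pos ht.1] at h2
    nlinarith [mul_le_mul_of_nonneg_right h2 (norm_nonneg d)]
  have := hanti (Set.left_mem_Icc.2 zero_le_one) (Set.right_mem_Icc.2 zero_le_one) zero_le_one
  simp [ψ, -inner_gradient_left] at this
  linarith

/-- The Baillon–Haddad theorem: a Lipschitz continuous gradient of a convex function is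
cocoercive. -/
theorem ConvexOn.gradient_cocoercive {f : E → ℝ} {L : ℝ} (hL : 0 < L)
    (hc : ConvexOn ℝ Set.univ f) (hf : Differentiable ℝ f)
    (hlip : ∀ z w : E, ‖gradient f z - gradient f w‖ ≤ L * ‖z - w‖) (x y : E) :
    ‖gradient f x - gradient f y‖ ^ 2 ≤ L * inner ℝ (gradient f x - gradient f y) (x - y) := by
  -- At y + d / L the tangent of f at x is a lower bound and the descent lemma from y an upper one;
  -- the step 1 / L maximizes the gain. Adding `key` for (x, y) and (y, x) gives cocoercivity.
  have key : ∀ x y : E, f x + inner ℝ (gradient f x) (y - x)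
      + 1 / (2 * L) * ‖gradient f x - gradient f y‖ ^ 2 ≤ f y := by
    intro x y
    set d := gradient f x - gradient f y with hd
    have h1 := le_add_inner_gradient_add_sq hf hlip y ((1 / L) • d)
    have h2 := hc.inner_gradient_le hf x (y + (1 / L) • d)
    have h3 : inner ℝ (gradient f x) d - inner ℝ (gradient f y) d = ‖d‖ ^ 2 := by
      rw [← inner_sub_left, ← hd, real_inner_self_eq_norm_sq]
    rw [add_sub_right_comm, inner_add_right, inner_smul_right] at h2
    rw [inner_smul_right, norm_smul, mul_pow, Real.norm_eq_abs, sq_abs] at h1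
    have h4 : L / 2 * ((1 / L) ^ 2 * ‖d‖ ^ 2) = 1 / (2 * L) * ‖d‖ ^ 2 := by field_simp
    have h5 : 1 / L * (inner ℝ (gradient f x) d - inner ℝ (gradient f y) d)
      = 2 * (1 / (2 * L) * ‖d‖ ^ 2) := by rw [h3]; field_simp
    linarith
  have h1 := key x y
  have h2 := key y x
  rw [norm_sub_rev] at h2
  have h3 : inner ℝ (gradient f x) (y - x) = - inner ℝ (gradient f x) (x - y) := by
    rw [← inner_neg_right, neg_sub]
  rw [h3] at h1
  rw [inner_sub_left]
  have h4 : 1 / (2 * L) * ‖gradient f x - gradient f y‖ ^ 2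
      + 1 / (2 * L) * ‖gradient f x - gradient f y‖ ^ 2
      = ‖gradient f x - gradient f y‖ ^ 2 / L := by field_simp; ring
  have h5 : ‖gradient f x - gradient f y‖ ^ 2 / L ≤
    inner ℝ (gradient f x) (x - y) - inner ℝ (gradient f y) (x - y) := by linarith
  rwa [div_le_iff₀ hL, mul_comm] at h5

end Smooth

/-! ### Weak convergence along filters. -/

section WeakConvergence

variable {E : Type*} [NormedAddCommGroup E] [InnerProductSpace ℝ E]

/-- `w` converges weakly to `a` along `l`, tested against inner products. -/
def WeakTendsto {ι : Type*} (w : ι → E) (l : Filter ι) (a : E) : Prop :=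
  ∀ y : E, Tendsto (fun k => (inner ℝ (w k) y : ℝ)) l (𝓝 (inner ℝ a y))

/-- Along an ultrafilter every bounded scalar family converges, so the pairings have limits without
subsequences or separability; these form a bounded functional, represented by Riesz. -/
theorem exists_weakTendsto_ultrafilter [CompleteSpace E] {ι : Type*} (U : Ultrafilter ι)
    {w : ι → E} {R : ℝ} (hw : ∀ k, ‖w k‖ ≤ R) : ∃ a, WeakTendsto w U a := by
  have hb : ∀ y k, |(inner ℝ (w k) y : ℝ)| ≤ R * ‖y‖ := fun y k =>
    (abs_real_inner_le_norm _ _).trans (mul_le_mul_of_nonneg_right (hw k) (norm_nonneg y))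
  have hex : ∀ y : E, ∃ r ∈ Set.Icc (-(R * ‖y‖)) (R * ‖y‖),
      Tendsto (fun k => (inner ℝ (w k) y : ℝ)) U (𝓝 r) := fun y =>
    isCompact_Icc.ultrafilter_le_nhds (U.map fun k => (inner ℝ (w k) y : ℝ))
      (le_principal_iff.2 (mem_map.2 (Eventually.of_forall fun k => abs_le.1 (hb y k))))
  choose ℓ hℓ hlim using hex
  let φ : E →ₗ[ℝ] ℝ :=
    { toFun := ℓ
      map_add' := fun y z => tendsto_nhds_unique (hlim (y + z)) (by
        simpa only [inner_add_right] using (hlim y).add (hlim z))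
      map_smul' := fun r y => tendsto_nhds_unique (hlim (r • y)) (by
        simpa only [inner_smul_right, RingHom.id_apply, smul_eq_mul] using (hlim y).const_mul r) }
  let Φ : StrongDual ℝ E := φ.mkContinuous R fun y => abs_le.2 (hℓ y)
  refine ⟨(InnerProductSpace.toDual ℝ E).symm Φ, fun y => ?_⟩
  rw [InnerProductSpace.toDual_symm_apply]
  exact hlim y

/-- Mazur: a point outside the set would be strictly separated from it by a functional. -/
theorem WeakTendsto.mem_of_closed_convex [CompleteSpace E] {ι : Type*} {l : Filter ι} [l.NeBot]
    {w : ι → E} {a : E} (hw : WeakTendsto w l a) {s : Set E} (hs : Convex ℝ s)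
    (hcl : IsClosed s) (hmem : ∀ᶠ k in l, w k ∈ s) : a ∈ s := by
  by_contra ha
  obtain ⟨φ, r, h1, h2⟩ := geometric_hahn_banach_point_closed hs hcl ha
  have key : ∀ b, φ b = inner ℝ b ((InnerProductSpace.toDual ℝ E).symm φ) := fun b => by
    rw [real_inner_comm, InnerProductSpace.toDual_symm_apply]
  have := ge_of_tendsto (hw ((InnerProductSpace.toDual ℝ E).symm φ)) (b := r)
    (hmem.mono fun k hk => by rw [← key]; exact (h2 _ hk).le)
  rw [← key] at this
  linarith

theorem WeakTendsto.inner_tendsto {ι : Type*} {l : Filter ι} {w v : ι → E} {a b : E} {R : ℝ}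
    (hw : WeakTendsto w l a) (hR : ∀ k, ‖w k‖ ≤ R) (hv : Tendsto v l (𝓝 b)) :
    Tendsto (fun k => (inner ℝ (w k) (v k) : ℝ)) l (𝓝 (inner ℝ a b)) := by
  have h0 : Tendsto (fun k => (inner ℝ (w k) (v k - b) : ℝ)) l (𝓝 0) := by
    refine squeeze_zero_norm (a := fun k => R * ‖v k - b‖) (fun k => ?_) ?_
    · exact (norm_inner_le_norm _ _).trans (mul_le_mul_of_nonneg_right (hR k) (norm_nonneg _))
    · simpa using (tendsto_iff_norm_sub_tendsto_zero.1 hv).const_mul R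
  simpa [inner_sub_right] using h0.add (hw b)

theorem WeakTendsto.add_strong {ι : Type*} {l : Filter ι} {w v : ι → E} {a b : E}
    (hw : WeakTendsto w l a) (hv : Tendsto v l (𝓝 b)) :
    WeakTendsto (fun k => w k + v k) l (a + b) := fun y => by
  simpa only [inner_add_left] using (hw y).add (hv.inner tendsto_const_nhds)

theorem WeakTendsto.map [CompleteSpace E] {ι : Type*} {l : Filter ι} {w : ι → E} {a : E}
    (hw : WeakTendsto w l a) (T : E →L[ℝ] E) : WeakTendsto (fun k => T (w k)) l (T a) := fun y => by
  simpa only [ContinuousLinearMap.adjoint_inner_right] using hw (ContinuousLinearMap.adjoint T y)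

end WeakConvergence

/-! ### Subdifferentials and weak lower semicontinuity. -/

section Subdifferential

variable {E : Type*} [NormedAddCommGroup E] [InnerProductSpace ℝ E]

theorem IsGammaZero.ne_top_of_mem_subdiff {φ : E → EReal} (hφ : IsGammaZero φ) {x v : E}
    (hv : v ∈ subdiff φ x) : φ x ≠ ⊤ := by
  obtain ⟨y, hy⟩ := hφ.exists_ne_top
  intro htop
  have := hv y
  rw [htop, EReal.top_add_coe, top_le_iff] at this
  exact hy this

theorem IsGammaZero.subdiff_monotone {φ : E → EReal} (hφ : IsGammaZero φ) {x y p q : E}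
    (hp : p ∈ subdiff φ x) (hq : q ∈ subdiff φ y) : 0 ≤ (inner ℝ (p - q) (x - y) : ℝ) := by
  have h1 := hp y
  have h2 := hq x
  lift φ x to ℝ using ⟨hφ.ne_top_of_mem_subdiff hp, hφ.ne_bot x⟩ with r
  lift φ y to ℝ using ⟨hφ.ne_top_of_mem_subdiff hq, hφ.ne_bot y⟩ with s
  norm_cast at h1 h2
  have h3 : (inner ℝ (y - x) p : ℝ) = - inner ℝ p (x - y) := by
    rw [real_inner_comm, ← inner_neg_right, neg_sub]
  rw [h3] at h1
  rw [real_inner_comm] at h2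
  rw [inner_sub_left]
  linarith

theorem IsGammaZero.convex_sublevel {φ : E → EReal} (hφ : IsGammaZero φ) (r : ℝ) :
    Convex ℝ {x | φ x ≤ r} := by
  rw [convex_iff_forall_pos]
  intro x hx y hy a b ha hb hab
  refine (hφ.convex x y a b ha hb hab).trans ?_
  calc (a : EReal) * φ x + (b : EReal) * φ y ≤ (a : EReal) * r + (b : EReal) * r := by
        gcongr
        · exact hx
        · exact hy
    _ = r := by
        norm_cast
        rw [← add_mul, hab, one_mul]

theorem IsGammaZero.le_of_weakTendsto [CompleteSpace E] {φ : E → EReal} (hφ : IsGammaZero φ)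
    {ι : Type*} {l : Filter ι} [l.NeBot] {w : ι → E} {a : E} (hw : WeakTendsto w l a) {r : ℝ}
    (hr : ∀ᶠ k in l, φ (w k) ≤ r) : φ a ≤ r :=
  hw.mem_of_closed_convex (hφ.convex_sublevel r) (hφ.lsc.isClosed_preimage (r : EReal)) hr

end Subdifferential

/-- Used with q the squared P-distance to a zero and e the decrease guaranteed at each step. -/
theorem exists_tendsto_of_add_le {q e : ℕ → ℝ} (hq : ∀ k, 0 ≤ q k) (he : ∀ k, 0 ≤ e k)
    (h : ∀ k, q (k + 1) + e k ≤ q k) :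
    (∀ k, q k ≤ q 0) ∧ (∃ r, Tendsto q atTop (𝓝 r)) ∧ Tendsto e atTop (𝓝 0) := by
  have hanti : Antitone q := antitone_nat_of_succ_le fun k => by linarith [h k, he k]
  have hlim := tendsto_atTop_ciInf hanti ⟨0, by rintro _ ⟨k, rfl⟩; exact hq k⟩
  refine ⟨fun k => hanti k.zero_le, ⟨_, hlim⟩, ?_⟩
  have h2 := hlim.sub (hlim.comp (tendsto_add_atTop_nat 1))
  rw [sub_self] at h2
  exact squeeze_zero he (fun k => by simp only [Function.comp]; linarith [h k]) h2

/-! ### Preconditioned forward-backward splitting. -/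

section ForwardBackward

variable {E : Type*} [NormedAddCommGroup E] [InnerProductSpace ℝ E]
  {Ψ : E → EReal} {C : E → E} {S P : E →L[ℝ] E} {c : ℝ} {w : ℕ → E}

/-- Monotonicity of ∂Ψ is tested between the new iterate and z. Skewness removes S, the three-point
identity for P (`h4`) produces the two distances, and `hslack` controls the remainder. -/
theorem forwardBackward_fejer (hΨ : IsGammaZero Ψ) (hS : ∀ a, (inner ℝ (S a) a : ℝ) = 0)
    (hP : ∀ a b, (inner ℝ (P a) b : ℝ) = inner ℝ a (P b))
    (hslack : ∀ a b z, c * (‖b - a‖ ^ 2 + ‖C a - C z‖ ^ 2) ≤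
      2 * inner ℝ (C a - C z) (b - z) + inner ℝ (P (b - a)) (b - a))
    (hw : ∀ k, P (w k - w (k + 1)) - C (w k) - S (w (k + 1)) ∈ subdiff Ψ (w (k + 1)))
    {z : E} (hz : -C z - S z ∈ subdiff Ψ z) (k : ℕ) :
    (inner ℝ (P (w (k + 1) - z)) (w (k + 1) - z) : ℝ)
        + c * (‖w (k + 1) - w k‖ ^ 2 + ‖C (w k) - C z‖ ^ 2)
      ≤ inner ℝ (P (w k - z)) (w k - z) := by
  have h1 := hΨ.subdiff_monotone (hw k) hz
  have h2 := hslack (w k) (w (k + 1)) z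
  set a := w k
  set b := w (k + 1)
  have h3 : P (a - b) - C a - S b - (-C z - S z) = P (a - b) - (C a - C z) - S (b - z) := by
    rw [map_sub S]; abel
  rw [h3, inner_sub_left, inner_sub_left, hS] at h1
  have h4 : (inner ℝ (P (a - z)) (a - z) : ℝ) = inner ℝ (P (b - a)) (b - a)
      + 2 * inner ℝ (P (a - b)) (b - z) + inner ℝ (P (b - z)) (b - z) := by
    have e1 : a - z = (a - b) + (b - z) := by abel
    have e2 : b - a = -(a - b) := by abel
    rw [e2, map_neg, inner_neg_neg, e1, map_add, inner_add_left, inner_add_right, inner_add_right,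
      hP (b - z) (a - b), real_inner_comm (P (a - b)) (b - z)]
    ring
  linarith

theorem forwardBackward_weak_cluster [CompleteSpace E] (hΨ : IsGammaZero Ψ)
    (hS : ∀ a, (inner ℝ (S a) a : ℝ) = 0) (hc : 0 < c)
    (hslack : ∀ a b z, c * (‖b - a‖ ^ 2 + ‖C a - C z‖ ^ 2) ≤
      2 * inner ℝ (C a - C z) (b - z) + inner ℝ (P (b - a)) (b - a))
    (hw : ∀ k, P (w k - w (k + 1)) - C (w k) - S (w (k + 1)) ∈ subdiff Ψ (w (k + 1)))
    {R : ℝ} (hR : ∀ k, ‖w k‖ ≤ R) {l : Filter ℕ} [l.NeBot] {a d : E} (ha : WeakTendsto w l a)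
    (hstep : Tendsto (fun k => w (k + 1) - w k) l (𝓝 0))
    (hd : Tendsto (fun k => C (w k)) l (𝓝 d)) : -C a - S a ∈ subdiff Ψ a := by
  -- Taking b = a in `hslack` removes P and leaves cocoercivity of C; its right side tends to 0 as a
  -- weak-times-strong product.
  have hda : d = C a := by
    have h1 : Tendsto (fun k => (inner ℝ (w k - a) (C (w k) - C a) : ℝ)) l (𝓝 0) := by
      have h2 : WeakTendsto (fun k => w k - a) l 0 := by
        simpa [sub_eq_add_neg] using ha.add_strong (tendsto_const_nhds (x := -a))
      simpa using h2.inner_tendsto (R := R + ‖a‖)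
        (fun k => (norm_sub_le _ _).trans (by linarith [hR k])) (hd.sub_const (C a))
    have h3 : Tendsto (fun k => c * ‖C (w k) - C a‖ ^ 2) l (𝓝 (c * ‖d - C a‖ ^ 2)) :=
      ((hd.sub_const (C a)).norm.pow 2).const_mul c
    have h4 : c * ‖d - C a‖ ^ 2 ≤ 2 * 0 :=
      le_of_tendsto_of_tendsto' h3 (h1.const_mul 2) fun k => by
        have := hslack (w k) (w k) a
        simpa [real_inner_comm] using this
    have h5 : ‖d - C a‖ ^ 2 ≤ 0 := by nlinarith
    exact sub_eq_zero.1 (norm_eq_zero.1 (pow_eq_zero_iff two_ne_zero |>.1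
      (le_antisymm h5 (sq_nonneg _))))
  subst hda
  have ha' : WeakTendsto (fun k => w (k + 1)) l a := by
    simpa using ha.add_strong hstep
  intro y
  by_cases hy : Ψ y = ⊤
  · rw [hy]; exact le_top
  lift Ψ y to ℝ using ⟨hy, hΨ.ne_bot y⟩ with r hr
  have hlim : Tendsto (fun k => r - (inner ℝ (y - w (k + 1))
      (P (w k - w (k + 1)) - C (w k) - S (w (k + 1))) : ℝ)) l
      (𝓝 (r - inner ℝ (y - a) (-C a - S a))) := by
    refine Tendsto.const_sub r ?_
    -- The product of b with S b pairs two merely weakly convergent sequences; skewness makes it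
    -- vanish, leaving a term linear in b.
    have e : ∀ (b p : E), (inner ℝ (y - b) (p - S b) : ℝ)
        = inner ℝ (y - b) p - inner ℝ (S b) y := by
      intro b p
      rw [inner_sub_right, inner_sub_left y b (S b), real_inner_comm (S b) b, hS,
        real_inner_comm (S b) y, sub_zero]
    simp only [e]
    refine Tendsto.sub ?_ (ha'.map S y)
    have h2 : WeakTendsto (fun k => y - w (k + 1)) l (y - a) := fun x => by
      simpa only [inner_sub_left] using (ha' x).const_sub (inner ℝ y x)
    refine h2.inner_tendsto (R := ‖y‖ + R)
      (fun k => (norm_sub_le _ _).trans (by linarith [hR (k + 1)])) ?_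
    have h3 : Tendsto (fun k => P (w k - w (k + 1))) l (𝓝 0) := by
      have := (P.continuous.tendsto 0).comp (by simpa using hstep.neg)
      simpa [Function.comp_def] using this
    simpa using h3.sub hd
  -- The upper bounds for Ψ (w (k + 1)) vary with k, so weak lower semicontinuity is applied at each
  -- level t above their limit.
  have hle : Ψ a ≤ ((r - inner ℝ (y - a) (-C a - S a) : ℝ) : EReal) := by
    rw [← EReal.le_of_forall_lt_iff_le]
    intro t ht
    refine hΨ.le_of_weakTendsto ha' ?_
    filter_upwards [hlim.eventually_lt_const (EReal.coe_lt_coe_iff.1 ht)] with k hk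
    have h1 := hw k y
    rw [← hr] at h1
    lift Ψ (w (k + 1)) to ℝ using ⟨hΨ.ne_top_of_mem_subdiff (hw k), hΨ.ne_bot _⟩ with s
    norm_cast at h1 ⊢
    linarith
  calc Ψ a + ((inner ℝ (y - a) (-C a - S a) : ℝ) : EReal)
      ≤ ((r - inner ℝ (y - a) (-C a - S a) : ℝ) : EReal)
        + ((inner ℝ (y - a) (-C a - S a) : ℝ) : EReal) := by gcongr
    _ = r := by norm_cast; ring

/-- Weak convergence of the preconditioned forward-backward iteration
`P (w k - w (k + 1)) - C (w k) - S (w (k + 1)) ∈ ∂Ψ (w (k + 1))` with `S` skew-symmetric. -/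
theorem forwardBackward_weakTendsto [CompleteSpace E] (hΨ : IsGammaZero Ψ)
    (hS : ∀ a, (inner ℝ (S a) a : ℝ) = 0)
    (hP : ∀ a b, (inner ℝ (P a) b : ℝ) = inner ℝ a (P b)) (hc : 0 < c)
    (hslack : ∀ a b z, c * (‖b - a‖ ^ 2 + ‖C a - C z‖ ^ 2) ≤
      2 * inner ℝ (C a - C z) (b - z) + inner ℝ (P (b - a)) (b - a))
    (hw : ∀ k, P (w k - w (k + 1)) - C (w k) - S (w (k + 1)) ∈ subdiff Ψ (w (k + 1)))
    (hex : ∃ z, -C z - S z ∈ subdiff Ψ z) :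
    ∃ z, -C z - S z ∈ subdiff Ψ z ∧ WeakTendsto w atTop z := by
  -- With both arguments of C equal to 0, `hslack` reduces to coercivity of P.
  have hpos : ∀ a, c * ‖a‖ ^ 2 ≤ inner ℝ (P a) a := fun a => by
    simpa using hslack 0 a 0
  have hfejer : ∀ z, -C z - S z ∈ subdiff Ψ z → _ := fun z hz =>
    exists_tendsto_of_add_le (q := fun k => (inner ℝ (P (w k - z)) (w k - z) : ℝ))
      (e := fun k => c * (‖w (k + 1) - w k‖ ^ 2 + ‖C (w k) - C z‖ ^ 2))
      (fun k => le_trans (by positivity) (hpos _)) (fun k => by positivity)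
      (forwardBackward_fejer hΨ hS hP hslack hw hz)
  obtain ⟨z₀, hz₀⟩ := hex
  obtain ⟨hbdd, -, herr⟩ := hfejer z₀ hz₀
  set M : ℝ := inner ℝ (P (w 0 - z₀)) (w 0 - z₀)
  have hR : ∀ k, ‖w k‖ ≤ √(M / c) + ‖z₀‖ := fun k => by
    have h1 : ‖w k - z₀‖ ≤ √(M / c) := by
      refine Real.le_sqrt_of_sq_le ?_
      rw [le_div_iff₀ hc, mul_comm]
      exact (hpos _).trans (hbdd k)
    linarith [norm_le_norm_sub_add (w k) z₀]
  have hsum : Tendsto (fun k => ‖w (k + 1) - w k‖ ^ 2 + ‖C (w k) - C z₀‖ ^ 2) atTop (𝓝 0) := by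
    have := herr.const_mul c⁻¹
    simpa only [mul_zero, inv_mul_cancel_left₀ hc.ne'] using this
  have hsq : ∀ v : ℕ → E, (∀ k, ‖v k‖ ^ 2 ≤ ‖w (k + 1) - w k‖ ^ 2 + ‖C (w k) - C z₀‖ ^ 2) →
      Tendsto v atTop (𝓝 0) := fun v hv => by
    have h1 := (squeeze_zero (fun k => sq_nonneg ‖v k‖) hv hsum).sqrt
    simp only [Real.sqrt_sq (norm_nonneg _), Real.sqrt_zero] at h1
    exact tendsto_zero_iff_norm_tendsto_zero.2 h1
  have hstep : Tendsto (fun k => w (k + 1) - w k) atTop (𝓝 0) :=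
    hsq _ fun k => by linarith [sq_nonneg ‖C (w k) - C z₀‖]
  have hd : Tendsto (fun k => C (w k)) atTop (𝓝 (C z₀)) :=
    tendsto_sub_nhds_zero_iff.1 (hsq _ fun k => by linarith [sq_nonneg ‖w (k + 1) - w k‖])
  have hcluster : ∀ U : Ultrafilter ℕ, (U : Filter ℕ) ≤ atTop →
      ∃ a, WeakTendsto w U a ∧ -C a - S a ∈ subdiff Ψ a := fun U hU => by
    obtain ⟨a, ha⟩ := exists_weakTendsto_ultrafilter U hR
    exact ⟨a, ha, forwardBackward_weak_cluster hΨ hS hc hslack hw hR ha (hstep.mono_left hU)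
      (hd.mono_left hU)⟩
  obtain ⟨a, ha, hsol⟩ := hcluster (Ultrafilter.of atTop) (Ultrafilter.of_le _)
  refine ⟨a, hsol, fun y => (tendsto_iff_ultrafilter _ _ _).2 fun U hU => ?_⟩
  obtain ⟨b, hb, hsol'⟩ := hcluster U hU
  suffices hab : a = b by rw [hab]; exact hb y
  obtain ⟨-, ⟨r, hr⟩, -⟩ := hfejer a hsol
  obtain ⟨-, ⟨s, hs⟩, -⟩ := hfejer b hsol'
  -- Opial: the difference of squared P-distances to two zeros is affine in w k and converges along
  -- `atTop`. So a and b pair equally with P (a - b), and coercivity forces a = b.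
  have hdiff : ∀ k, (inner ℝ (w k) (P (a - b)) : ℝ) =
      ((inner ℝ (P (w k - b)) (w k - b) - inner ℝ (P (w k - a)) (w k - a))
        + (inner ℝ (P a) a - inner ℝ (P b) b)) / 2 := fun k => by
    simp only [map_sub, inner_sub_left, inner_sub_right, hP]
    have h1 : ∀ x y : E, (inner ℝ x (P y) : ℝ) = inner ℝ y (P x) := fun x y => by
      rw [← hP, real_inner_comm]
    rw [h1 a (w k), h1 b (w k)]
    ring
  have hlim := (((hs.sub hr).add_const (inner ℝ (P a) a - inner ℝ (P b) b : ℝ)).div_const 2)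
  simp only [← hdiff] at hlim
  have h1 := tendsto_nhds_unique (ha (P (a - b))) (hlim.mono_left (Ultrafilter.of_le _))
  have h2 := tendsto_nhds_unique (hb (P (a - b))) (hlim.mono_left hU)
  have h3 := hpos (a - b)
  rw [hP, inner_sub_left, h1, h2, sub_self] at h3
  have h4 : ‖a - b‖ ^ 2 ≤ 0 := by nlinarith
  exact sub_eq_zero.1 (norm_eq_zero.1 (pow_eq_zero_iff two_ne_zero |>.1
    (le_antisymm h4 (sq_nonneg _))))

end ForwardBackward

/-! ### Finite sums in the extended reals. -/

theorem EReal.coe_finsetSum {ι : Type*} (s : Finset ι) (r : ι → ℝ) :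
    ((∑ i ∈ s, r i : ℝ) : EReal) = ∑ i ∈ s, (r i : EReal) := by
  classical
  induction s using Finset.induction_on with
  | empty => simp
  | insert a s ha ih => rw [Finset.sum_insert ha, Finset.sum_insert ha, EReal.coe_add, ih]

theorem EReal.finsetSum_ne_top {ι : Type*} {s : Finset ι} {r : ι → EReal}
    (h : ∀ i ∈ s, r i ≠ ⊤) : ∑ i ∈ s, r i ≠ ⊤ := by
  classical
  induction s using Finset.induction_on with
  | empty => simp
  | insert a s ha ih =>
    rw [Finset.sum_insert ha]
    exact EReal.add_ne_top (h a (Finset.mem_insert_self a s))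
      (ih fun i hi => h i (Finset.mem_insert_of_mem hi))

theorem EReal.finsetSum_ne_bot {ι : Type*} {s : Finset ι} {r : ι → EReal}
    (h : ∀ i ∈ s, r i ≠ ⊥) : ∑ i ∈ s, r i ≠ ⊥ := by
  classical
  induction s using Finset.induction_on with
  | empty => simp
  | insert a s ha ih =>
    rw [Finset.sum_insert ha]
    exact EReal.add_ne_bot_iff.2 ⟨h a (Finset.mem_insert_self a s),
      ih fun i hi => h i (Finset.mem_insert_of_mem hi)⟩

/-! ### Stability of Γ₀, and optimality of proximal points. -/

section GammaZero

variable {E F : Type*} [NormedAddCommGroup E] [InnerProductSpace ℝ E]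
  [NormedAddCommGroup F] [InnerProductSpace ℝ F]

theorem IsGammaZero.zero : IsGammaZero (fun _ : E => (0 : EReal)) where
  ne_bot _ := EReal.zero_ne_bot
  exists_ne_top := ⟨0, EReal.zero_ne_top⟩
  lsc := lowerSemicontinuous_const
  convex _ _ _ _ _ _ _ := by simp

theorem IsGammaZero.add {φ ψ : E → EReal} (hφ : IsGammaZero φ) (hψ : IsGammaZero ψ)
    (hdom : ∃ x, φ x ≠ ⊤ ∧ ψ x ≠ ⊤) : IsGammaZero (fun x => φ x + ψ x) where
  ne_bot x := EReal.add_ne_bot_iff.2 ⟨hφ.ne_bot x, hψ.ne_bot x⟩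
  exists_ne_top := let ⟨x, h1, h2⟩ := hdom; ⟨x, EReal.add_ne_top h1 h2⟩
  lsc := hφ.lsc.add' hψ.lsc fun x =>
    EReal.continuousAt_add (Or.inr (hψ.ne_bot x)) (Or.inl (hφ.ne_bot x))
  convex x y a b ha hb hab := by
    rw [EReal.left_distrib_of_nonneg_of_ne_top (EReal.coe_nonneg.2 ha.le) (EReal.coe_ne_top a),
      EReal.left_distrib_of_nonneg_of_ne_top (EReal.coe_nonneg.2 hb.le) (EReal.coe_ne_top b),
      add_add_add_comm]
    exact add_le_add (hφ.convex x y a b ha hb hab) (hψ.convex x y a b ha hb hab)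

theorem IsGammaZero.comp_continuousLinearMap {φ : F → EReal} (hφ : IsGammaZero φ) (T : E →L[ℝ] F)
    (hdom : ∃ x, φ (T x) ≠ ⊤) : IsGammaZero (fun x => φ (T x)) where
  ne_bot x := hφ.ne_bot (T x)
  exists_ne_top := hdom
  lsc := hφ.lsc.comp T.continuous
  convex x y a b ha hb hab := by
    rw [map_add, map_smul, map_smul]
    exact hφ.convex _ _ a b ha hb hab

theorem IsGammaZero.finsetSum {ι : Type*} {s : Finset ι} {φ : ι → E → EReal}
    (hφ : ∀ i ∈ s, IsGammaZero (φ i)) {x₀ : E} (hdom : ∀ i ∈ s, φ i x₀ ≠ ⊤) :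
    IsGammaZero (fun x => ∑ i ∈ s, φ i x) := by
  classical
  induction s using Finset.induction_on with
  | empty => simpa using IsGammaZero.zero
  | insert a s ha ih =>
    simp only [Finset.sum_insert ha]
    have h2 : ∀ i ∈ s, φ i x₀ ≠ ⊤ := fun i hi => hdom i (Finset.mem_insert_of_mem hi)
    exact (hφ a (Finset.mem_insert_self a s)).add
      (ih (fun i hi => hφ i (Finset.mem_insert_of_mem hi)) h2)
      ⟨x₀, hdom a (Finset.mem_insert_self a s), EReal.finsetSum_ne_top h2⟩

/-- Minimality is tested against (1 - t) p + t z; convexity allows division by t, and t → 0 removes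
the quadratic term. -/
theorem IsProx.smul_sub_mem_subdiff {φ : E → EReal} (hφ : IsGammaZero φ) {lam : ℝ}
    (hlam : 0 < lam) {u p : E} (hp : IsProx lam φ u p) : (1 / lam) • (u - p) ∈ subdiff φ p := by
  have hmin : ∀ x, (((1 / 2 : ℝ) * ‖p - u‖ ^ 2 : ℝ) : EReal) + (lam : EReal) * φ p ≤
      (((1 / 2 : ℝ) * ‖x - u‖ ^ 2 : ℝ) : EReal) + (lam : EReal) * φ x := fun x =>
    hp (Set.mem_univ x)
  have hpt : φ p ≠ ⊤ := by
    obtain ⟨y, hy⟩ := hφ.exists_ne_top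
    intro htop
    have h1 := hmin y
    rw [htop, EReal.coe_mul_top_of_pos hlam, EReal.coe_add_top, top_le_iff] at h1
    lift φ y to ℝ using ⟨hy, hφ.ne_bot y⟩ with s
    rw [← EReal.coe_mul, ← EReal.coe_add] at h1
    exact EReal.coe_ne_top _ h1
  intro z
  by_cases hz : φ z = ⊤
  · rw [hz]; exact le_top
  have hseg : ∀ t : ℝ, t ∈ Set.Ioo (0 : ℝ) 1 →
      lam * (φ p).toReal ≤ lam * (φ z).toReal + inner ℝ (p - u) (z - p) + t / 2 * ‖z - p‖ ^ 2 := by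
    intro t ht
    have h1 := hmin ((1 - t) • p + t • z)
    have h2 := hφ.convex p z (1 - t) t (by linarith [ht.2]) ht.1 (by ring)
    have hne : φ ((1 - t) • p + t • z) ≠ ⊤ := by
      refine ne_top_of_le_ne_top ?_ h2
      lift φ p to ℝ using ⟨hpt, hφ.ne_bot p⟩ with r
      lift φ z to ℝ using ⟨hz, hφ.ne_bot z⟩ with s
      rw [← EReal.coe_mul, ← EReal.coe_mul, ← EReal.coe_add]
      exact EReal.coe_ne_top _
    lift φ ((1 - t) • p + t • z) to ℝ using ⟨hne, hφ.ne_bot _⟩ with q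
    lift φ p to ℝ using ⟨hpt, hφ.ne_bot p⟩ with r
    lift φ z to ℝ using ⟨hz, hφ.ne_bot z⟩ with s
    norm_cast at h1 h2
    simp only [EReal.toReal_coe]
    have h3 : (1 - t) • p + t • z - u = (p - u) + t • (z - p) := by module
    rw [h3, norm_add_sq_real, inner_smul_right, norm_smul, mul_pow, Real.norm_eq_abs, sq_abs] at h1
    have h4 := mul_le_mul_of_nonneg_left h2 hlam.le
    have h5 : t * (lam * r) ≤ t * (lam * s + inner ℝ (p - u) (z - p) + t / 2 * ‖z - p‖ ^ 2) := by
      linarith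
    exact le_of_mul_le_mul_left h5 ht.1
  have hlim : lam * (φ p).toReal ≤ lam * (φ z).toReal + inner ℝ (p - u) (z - p) := by
    have h1 : Tendsto (fun t : ℝ => lam * (φ z).toReal + inner ℝ (p - u) (z - p)
        + t / 2 * ‖z - p‖ ^ 2) (𝓝[>] 0) (𝓝 (lam * (φ z).toReal + inner ℝ (p - u) (z - p)
        + 0 / 2 * ‖z - p‖ ^ 2)) :=
      (Continuous.tendsto (by fun_prop) 0).mono_left nhdsWithin_le_nhds
    have h2 := ge_of_tendsto h1 (by
      filter_upwards [Ioo_mem_nhdsGT (zero_lt_one' ℝ)] with t ht using hseg t ht)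
    simpa using h2
  lift φ p to ℝ using ⟨hpt, hφ.ne_bot p⟩ with r
  lift φ z to ℝ using ⟨hz, hφ.ne_bot z⟩ with s
  simp only [EReal.toReal_coe] at hlim
  norm_cast
  have h1 : (inner ℝ (z - p) ((1 / lam) • (u - p)) : ℝ) = -(inner ℝ (p - u) (z - p)) / lam := by
    rw [inner_smul_right, real_inner_comm, ← neg_sub p u, inner_neg_left]
    ring
  rw [h1]
  have h2 : lam * (r + -(inner ℝ (p - u) (z - p)) / lam) ≤ lam * s := by
    field_simp
    linarith
  exact le_of_mul_le_mul_left h2 hlam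

end GammaZero

/-! ### Fenchel conjugates. -/

section Conjugate

variable {E : Type*} [NormedAddCommGroup E] [InnerProductSpace ℝ E] {φ : E → EReal}

theorem fenchelConj_le_coe_iff {y : E} {r : ℝ} :
    fenchelConj φ y ≤ r ↔ ∀ x, ((inner ℝ x y - r : ℝ) : EReal) ≤ φ x := by
  refine iSup_le_iff.trans (forall_congr' fun x => ?_)
  induction φ x with
  | bot =>
    have : ¬ (⊤ : EReal) ≤ r := by simp
    simp [this, -EReal.coe_sub]
  | top => simp
  | coe s => norm_cast; constructor <;> intro h <;> linarith

theorem coe_inner_sub_le_fenchelConj {x y : E} {r : ℝ} (hx : φ x = r) :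
    ((inner ℝ x y - r : ℝ) : EReal) ≤ fenchelConj φ y := by
  have := le_iSup (fun x : E => ((inner ℝ x y : ℝ) : EReal) - φ x) x
  simp only [hx] at this
  exact_mod_cast this

theorem IsGammaZero.fenchelConj (hφ : IsGammaZero φ) (hdom : ∃ v, fenchelConj φ v ≠ ⊤) :
    IsGammaZero (fenchelConj φ) where
  ne_bot y := by
    obtain ⟨x, hx⟩ := hφ.exists_ne_top
    have := coe_inner_sub_le_fenchelConj (y := y) (EReal.coe_toReal hx (hφ.ne_bot x)).symm
    exact ne_bot_of_le_ne_bot (EReal.coe_ne_bot _) this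
  exists_ne_top := hdom
  lsc := by
    refine lowerSemicontinuous_iSup fun x => ?_
    by_cases hx : φ x = ⊤
    · simpa [hx] using lowerSemicontinuous_const
    · lift φ x to ℝ using ⟨hx, hφ.ne_bot x⟩ with s
      refine Continuous.lowerSemicontinuous ?_
      norm_cast
      exact continuous_coe_real_ereal.comp (by fun_prop)
  convex y z a b ha hb hab := by
    refine iSup_le fun x => ?_
    by_cases hx : φ x = ⊤
    · simp [hx]
    · have hs := (EReal.coe_toReal hx (hφ.ne_bot x)).symm
      set s := (φ x).toReal
      rw [hs]
      calc ((inner ℝ x (a • y + b • z) : ℝ) : EReal) - s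
          = (a : EReal) * ((inner ℝ x y - s : ℝ) : EReal)
            + (b : EReal) * ((inner ℝ x z - s : ℝ) : EReal) := by
            norm_cast
            rw [inner_add_right, inner_smul_right, inner_smul_right]
            linear_combination s * hab
        _ ≤ _ := by
            gcongr
            · exact coe_inner_sub_le_fenchelConj hs
            · exact coe_inner_sub_le_fenchelConj hs

theorem fenchelConj_le_of_mem_subdiff {x v : E} {r : ℝ} (hx : φ x = r) (hv : v ∈ subdiff φ x) :
    fenchelConj φ v ≤ ((inner ℝ x v - r : ℝ) : EReal) := by
  rw [fenchelConj_le_coe_iff]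
  intro z
  refine le_trans (le_of_eq ?_) (hv z)
  rw [hx, inner_sub_left]
  norm_cast
  ring

theorem IsGammaZero.fenchelConj_ne_top (hφ : IsGammaZero φ) {x v : E} (hv : v ∈ subdiff φ x) :
    _root_.fenchelConj φ v ≠ ⊤ :=
  ne_top_of_le_ne_top (EReal.coe_ne_top _) (fenchelConj_le_of_mem_subdiff
    (EReal.coe_toReal (hφ.ne_top_of_mem_subdiff hv) (hφ.ne_bot x)).symm hv)

/-- Equality in Fenchel–Young at (x, v), compared with the inequality at (x, w). -/
theorem IsGammaZero.mem_subdiff_fenchelConj (hφ : IsGammaZero φ) {x v : E}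
    (hv : v ∈ subdiff φ x) : x ∈ subdiff (_root_.fenchelConj φ) v := by
  have hx := (EReal.coe_toReal (hφ.ne_top_of_mem_subdiff hv) (hφ.ne_bot x)).symm
  set r := (φ x).toReal
  intro w
  calc _root_.fenchelConj φ v + ((inner ℝ (w - v) x : ℝ) : EReal)
      ≤ ((inner ℝ x v - r : ℝ) : EReal) + ((inner ℝ (w - v) x : ℝ) : EReal) := by
        gcongr
        exact fenchelConj_le_of_mem_subdiff hx hv
    _ = ((inner ℝ x w - r : ℝ) : EReal) := by
        norm_cast
        rw [inner_sub_left, real_inner_comm x w, real_inner_comm x v]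
        ring
    _ ≤ _ := coe_inner_sub_le_fenchelConj hx

theorem IsGammaZero.isClosed_realEpigraph (hφ : IsGammaZero φ) :
    IsClosed {p : E × ℝ | φ p.1 ≤ p.2} :=
  hφ.lsc.isClosed_epigraph.preimage
    (continuous_fst.prodMk (continuous_coe_real_ereal.comp continuous_snd))

theorem IsGammaZero.convex_realEpigraph (hφ : IsGammaZero φ) :
    Convex ℝ {p : E × ℝ | φ p.1 ≤ p.2} := by
  rw [convex_iff_forall_pos]
  rintro ⟨x, r⟩ hx ⟨y, s⟩ hy a b ha hb hab
  refine (hφ.convex x y a b ha hb hab).trans ?_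
  calc (a : EReal) * φ x + (b : EReal) * φ y ≤ (a : EReal) * r + (b : EReal) * s := by
        gcongr
        · exact hx
        · exact hy
    _ = _ := by
        simp

/-- The half of the Fenchel–Moreau theorem `φ** = φ` that inverts the conjugate subdifferential. -/
theorem IsGammaZero.mem_subdiff_of_fenchelConj [CompleteSpace E] (hφ : IsGammaZero φ) {a v : E}
    (ha : a ∈ subdiff (_root_.fenchelConj φ) v) (hv : _root_.fenchelConj φ v ≠ ⊤) :
    v ∈ subdiff φ a := by
  have hφ' := hφ.fenchelConj ⟨v, hv⟩
  have hs := (EReal.coe_toReal hv (hφ'.ne_bot v)).symm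
  set s := (_root_.fenchelConj φ v).toReal
  have hconj : ∀ x q, φ x = (q : ℝ) → inner ℝ x v - q ≤ s := fun x q hx => by
    have := coe_inner_sub_le_fenchelConj (y := v) hx
    rw [hs] at this
    exact_mod_cast this
  have hsub : ∀ ξ r, _root_.fenchelConj φ ξ ≤ (r : ℝ) → s + inner ℝ (ξ - v) a ≤ r := fun ξ r hr => by
    have := (ha ξ).trans hr
    rw [hs] at this
    exact_mod_cast this
  have hreal : ∀ ξ (r : ℝ), (∀ x q, φ x = (q : ℝ) → inner ℝ x ξ - q ≤ r) →
      _root_.fenchelConj φ ξ ≤ (r : ℝ) := fun ξ r h => by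
    rw [fenchelConj_le_coe_iff]
    intro x
    by_cases hx : φ x = ⊤
    · rw [hx]; exact le_top
    · have hq := (EReal.coe_toReal hx (hφ.ne_bot x)).symm
      have := h x _ hq
      rw [hq]
      norm_cast
      linarith
  -- Otherwise the point (a, ⟪a, v⟫ - s) can be strictly separated from the closed convex epigraph,
  -- by (x, t) ↦ ⟪x, ξ⟫ + t β.
  have key : φ a ≤ ((inner ℝ a v - s : ℝ) : EReal) := by
    by_contra hnot
    obtain ⟨Λ, c, h1, h2⟩ := geometric_hahn_banach_closed_point (x := (a, inner ℝ a v - s))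
      hφ.convex_realEpigraph hφ.isClosed_realEpigraph hnot
    set ξ := (InnerProductSpace.toDual ℝ E).symm (Λ.comp (ContinuousLinearMap.inl ℝ E ℝ)) with hξ
    set β := Λ (0, 1) with hβ
    have hΛ : ∀ x t, Λ (x, t) = inner ℝ x ξ + t * β := fun x t => by
      rw [real_inner_comm, hξ, InnerProductSpace.toDual_symm_apply, hβ, ← smul_eq_mul, ← map_smul]
      rw [ContinuousLinearMap.comp_apply, ContinuousLinearMap.inl_apply, ← map_add]
      simp
    rw [hΛ] at h2
    have h1' : ∀ x q t, φ x = (q : ℝ) → q ≤ t → inner ℝ x ξ + t * β < c := fun x q t hx hqt => by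
      rw [← hΛ]
      refine h1 (x, t) ?_
      simpa [hx] using hqt
    -- The epigraph is unbounded upwards, so β > 0 would violate the bound c.
    have hβ0 : β ≤ 0 := by
      by_contra hpos
      rw [not_le] at hpos
      obtain ⟨x, hx⟩ := hφ.exists_ne_top
      have h3 := h1' x _ (max (φ x).toReal ((c - inner ℝ x ξ) / β))
        (EReal.coe_toReal hx (hφ.ne_bot x)).symm (le_max_left _ _)
      have h4 := mul_le_mul_of_nonneg_right
        (le_max_right (φ x).toReal ((c - inner ℝ x ξ) / β)) hpos.le
      rw [div_mul_cancel₀ _ hpos.ne'] at h4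
      linarith
    rcases hβ0.eq_or_lt with hβ0 | hβ0
    -- Vertical hyperplane: ξ is bounded by c on the domain, so φ*(v + ξ) ≤ s + c, and the
    -- subgradient a at v gives ⟪ξ, a⟫ ≤ c, a contradiction.
    · have h3 := hsub (v + ξ) (s + c) (hreal _ _ fun x q hx => by
        have := h1' x q q hx le_rfl
        have := hconj x q hx
        rw [hβ0] at *
        rw [inner_add_right]
        linarith)
      rw [hβ0, mul_zero, add_zero] at h2
      rw [add_sub_cancel_left, real_inner_comm] at h3
      linarith
    -- Dividing by -β turns the hyperplane into an affine minorant of φ, that is, a bound on φ* at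
    -- its slope, which contradicts the subgradient inequality there.
    · have h3 := hsub ((1 / (-β)) • ξ) (1 / (-β) * c) (hreal _ _ fun x q hx => by
        have h4 := h1' x q q hx le_rfl
        have h5 : 1 / (-β) * (inner ℝ x ξ + q * β) ≤ 1 / (-β) * c :=
          mul_le_mul_of_nonneg_left h4.le (by rw [one_div_nonneg]; linarith)
        have h6 : 1 / (-β) * (q * β) = -q := by
          have := hβ0.ne
          field_simp
        rw [inner_smul_right]
        linarith)
      rw [inner_sub_left, inner_smul_left, real_inner_comm a ξ, real_inner_comm a v] at h3
      simp only [conj_trivial] at h3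
      have h4 : 1 / (-β) * c < 1 / (-β) * (inner ℝ a ξ + (inner ℝ a v - s) * β) :=
        mul_lt_mul_of_pos_left h2 (by rw [one_div_pos]; linarith)
      have h5 : 1 / (-β) * ((inner ℝ a v - s) * β) = -(inner ℝ a v - s) := by
        have := hβ0.ne
        field_simp
      linarith
  intro z
  by_cases hz : φ z = ⊤
  · rw [hz]; exact le_top
  have hq := (EReal.coe_toReal hz (hφ.ne_bot z)).symm
  have h1 := hconj z _ hq
  calc φ a + ((inner ℝ (z - a) v : ℝ) : EReal)
      ≤ ((inner ℝ a v - s : ℝ) : EReal) + ((inner ℝ (z - a) v : ℝ) : EReal) := by gcongr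
    _ ≤ φ z := by
      rw [hq]
      norm_cast
      rw [inner_sub_left]
      linarith

end Conjugate

/-! ### Separable sums on the Hilbert product. -/

section Products

variable {H : Type*} [NormedAddCommGroup H] [InnerProductSpace ℝ H]
  {ι : Type*} [Fintype ι] {G : ι → Type*} [∀ i, NormedAddCommGroup (G i)]
  [∀ i, InnerProductSpace ℝ (G i)]

/-- The separable sum `(x, v) ↦ g x + ∑ i, φ i (v i)` on the Hilbert product. -/
noncomputable def separableSum (g : H → EReal) (φ : ∀ i, G i → EReal)
    (w : WithLp 2 (H × PiLp 2 G)) : EReal :=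
  g w.fst + ∑ i, φ i (w.snd i)

variable {g : H → EReal} {φ : ∀ i, G i → EReal} {w : WithLp 2 (H × PiLp 2 G)}

theorem IsGammaZero.separableSum (hg : IsGammaZero g) (hφ : ∀ i, IsGammaZero (φ i)) :
    IsGammaZero (separableSum g φ) := by
  obtain ⟨x₀, hx₀⟩ := hg.exists_ne_top
  choose v₀ hv₀ using fun i => (hφ i).exists_ne_top
  let w₀ : WithLp 2 (H × PiLp 2 G) := WithLp.toLp 2 (x₀, WithLp.toLp 2 v₀)
  refine (hg.comp_continuousLinearMap (WithLp.fstL 2 ℝ H (PiLp 2 G)) ⟨w₀, hx₀⟩).add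
    (IsGammaZero.finsetSum (x₀ := w₀) (s := Finset.univ)
      (φ := fun i w => φ i (w.snd i)) (fun i _ => (hφ i).comp_continuousLinearMap
        ((PiLp.proj 2 G i : PiLp 2 G →L[ℝ] G i).comp (WithLp.sndL 2 ℝ H (PiLp 2 G)))
        ⟨w₀, hv₀ i⟩) (fun i _ => hv₀ i)) ⟨w₀, hx₀, EReal.finsetSum_ne_top fun i _ => hv₀ i⟩

theorem mem_subdiff_separableSum {d : WithLp 2 (H × PiLp 2 G)} (h₁ : d.fst ∈ subdiff g w.fst)
    (h₂ : ∀ i, d.snd i ∈ subdiff (φ i) (w.snd i)) : d ∈ subdiff (separableSum g φ) w := by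
  intro z
  have := add_le_add (h₁ z.fst) (Finset.sum_le_sum fun i (_ : i ∈ Finset.univ) => h₂ i (z.snd i))
  rw [Finset.sum_add_distrib, ← EReal.coe_finsetSum, add_add_add_comm, ← EReal.coe_add] at this
  rw [WithLp.prod_inner_apply, PiLp.inner_apply]
  exact this

theorem separableSum_ne_top_iff (hg : IsGammaZero g) (hφ : ∀ i, IsGammaZero (φ i)) :
    separableSum g φ w ≠ ⊤ ↔ g w.fst ≠ ⊤ ∧ ∀ i, φ i (w.snd i) ≠ ⊤ := by
  classical
  refine ⟨fun h => ?_, fun h => EReal.add_ne_top h.1 (EReal.finsetSum_ne_top fun i _ => h.2 i)⟩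
  have h1 := (EReal.add_ne_top_iff_ne_top₂ (hg.ne_bot _)
    (EReal.finsetSum_ne_bot fun i _ => (hφ i).ne_bot _)).1 h
  refine ⟨h1.1, fun i => ?_⟩
  have h2 := h1.2
  rw [← Finset.add_sum_erase _ _ (Finset.mem_univ i)] at h2
  exact ((EReal.add_ne_top_iff_ne_top₂ ((hφ i).ne_bot _)
    (EReal.finsetSum_ne_bot fun i _ => (hφ i).ne_bot _)).1 h2).1

/-- Only the first component is varied; the remaining sum is finite, so it cancels in `EReal`. -/
theorem subdiff_fst_of_separableSum (hg : IsGammaZero g) (hφ : ∀ i, IsGammaZero (φ i))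
    {d : WithLp 2 (H × PiLp 2 G)} (hd : d ∈ subdiff (separableSum g φ) w) :
    d.fst ∈ subdiff g w.fst := by
  have hfin := (separableSum_ne_top_iff hg hφ).1
    ((hg.separableSum hφ).ne_top_of_mem_subdiff hd)
  intro x
  have h := hd (WithLp.toLp 2 (x, w.snd))
  rw [WithLp.prod_inner_apply] at h
  change g w.fst + ∑ i, φ i (w.snd i) + ((inner ℝ (x - w.fst) d.fst
    + inner ℝ (w.snd - w.snd) d.snd : ℝ) : EReal) ≤ g x + ∑ i, φ i (w.snd i) at h
  rw [sub_self, inner_zero_left, add_zero] at h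
  have hs : ∑ i, φ i (w.snd i) ≠ ⊤ := EReal.finsetSum_ne_top fun i _ => hfin.2 i
  have hb : ∑ i, φ i (w.snd i) ≠ ⊥ := EReal.finsetSum_ne_bot fun i _ => (hφ i).ne_bot _
  lift ∑ i, φ i (w.snd i) to ℝ using ⟨hs, hb⟩ with s
  rw [add_right_comm] at h
  exact (EReal.addLECancellable_coe s).add_le_add_iff_right.1 h

theorem subdiff_snd_of_separableSum (hg : IsGammaZero g) (hφ : ∀ i, IsGammaZero (φ i))
    {d : WithLp 2 (H × PiLp 2 G)} (hd : d ∈ subdiff (separableSum g φ) w) (i : ι) :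
    d.snd i ∈ subdiff (φ i) (w.snd i) := by
  classical
  have hfin := (separableSum_ne_top_iff hg hφ).1
    ((hg.separableSum hφ).ne_top_of_mem_subdiff hd)
  intro y
  have h := hd (WithLp.toLp 2 (w.fst, WithLp.toLp 2 (Function.update w.snd.ofLp i y)))
  rw [WithLp.prod_inner_apply, PiLp.inner_apply] at h
  change g w.fst + ∑ j, φ j (w.snd j) + ((inner ℝ (w.fst - w.fst) d.fst
    + ∑ j, inner ℝ (Function.update w.snd.ofLp i y j - w.snd j) (d.snd j) : ℝ) : EReal)
    ≤ g w.fst + ∑ j, φ j (Function.update w.snd.ofLp i y j) at h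
  rw [sub_self, inner_zero_left, zero_add] at h
  rw [← Finset.add_sum_erase _ _ (Finset.mem_univ i), ← Finset.add_sum_erase _ _ (Finset.mem_univ i),
    ← Finset.add_sum_erase _ _ (Finset.mem_univ i)] at h
  have e1 : ∑ j ∈ Finset.univ.erase i, φ j (Function.update w.snd.ofLp i y j)
      = ∑ j ∈ Finset.univ.erase i, φ j (w.snd j) := Finset.sum_congr rfl fun j hj => by
    rw [Function.update_of_ne (Finset.ne_of_mem_erase hj)]
  have e2 : ∑ j ∈ Finset.univ.erase i,
      (inner ℝ (Function.update w.snd.ofLp i y j - w.snd j) (d.snd j) : ℝ) = 0 :=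
    Finset.sum_eq_zero fun j hj => by
      rw [Function.update_of_ne (Finset.ne_of_mem_erase hj), sub_self, inner_zero_left]
  rw [e1, e2, Function.update_self, add_zero] at h
  have hs : ∑ j ∈ Finset.univ.erase i, φ j (w.snd j) ≠ ⊤ :=
    EReal.finsetSum_ne_top fun i _ => hfin.2 i
  have hb : ∑ j ∈ Finset.univ.erase i, φ j (w.snd j) ≠ ⊥ :=
    EReal.finsetSum_ne_bot fun i _ => (hφ i).ne_bot _
  set A := ∑ j ∈ Finset.univ.erase i, φ j (w.snd j)
  have hA := (EReal.coe_toReal (EReal.add_ne_top hfin.1 hs)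
    (EReal.add_ne_bot_iff.2 ⟨hg.ne_bot _, hb⟩)).symm
  rw [add_left_comm, add_right_comm, add_left_comm _ (φ i y), hA] at h
  exact (EReal.addLECancellable_coe _).add_le_add_iff_right.1 h

end Products

/-! ### The scalar inequality behind the step-size condition. -/

theorem exists_pos_forall_le_coupled_quadratic {L r t N : ℝ} (hL : 0 < L) (ht : 0 < t) (hN : 0 ≤ N)
    (h : L / 2 + t * N < r) : ∃ c > 0, ∀ D X V Y i₁ i₂ i₃ : ℝ, D ^ 2 ≤ L * i₁ → |i₂| ≤ D * X →
      |i₃| ≤ Y * V → Y ^ 2 ≤ N * X ^ 2 →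
      c * (X ^ 2 + V ^ 2 + D ^ 2) ≤ 2 * (i₁ + i₂) + (r * X ^ 2 - 2 * i₃ + t⁻¹ * V ^ 2) := by
  -- The gap is split in three: enlarging L to `L'` and t to `t'` in the Young inequalities for D X
  -- and Y V costs at most ε X² each, and ε X² remains. The enlargements leave positive multiples of
  -- D² and V².
  set ε := (r - L / 2 - t * N) / 3 with hε
  have hεpos : 0 < ε := by rw [hε]; linarith
  set L' := L + 2 * ε
  have hL' : 0 < L' := by positivity
  -- The denominator `N + 1` allows N = 0.
  set t' := t + ε / (N + 1)
  have ht' : 0 < t' := by positivity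
  have hLL : 0 < 2 * L⁻¹ - 2 * L'⁻¹ := by
    have : L'⁻¹ < L⁻¹ := inv_strictAnti₀ hL (by simp only [L']; linarith)
    linarith
  have htt : 0 < t⁻¹ - t'⁻¹ := by
    have : t'⁻¹ < t⁻¹ := inv_strictAnti₀ ht (by
      have : 0 < ε / (N + 1) := by positivity
      simp only [t']; linarith)
    linarith
  have htN : t' * N ≤ t * N + ε := by
    have : ε / (N + 1) * N ≤ ε := by
      rw [div_mul_eq_mul_div, div_le_iff₀ (by positivity)]
      nlinarith
    simp only [t']
    linarith
  refine ⟨min (2 * L⁻¹ - 2 * L'⁻¹) (min ε (t⁻¹ - t'⁻¹)), by positivity, ?_⟩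
  intro D X V Y i₁ i₂ i₃ h₁ h₂ h₃ h₄
  set c := min (2 * L⁻¹ - 2 * L'⁻¹) (min ε (t⁻¹ - t'⁻¹))
  have hc1 : c ≤ 2 * L⁻¹ - 2 * L'⁻¹ := min_le_left _ _
  have hc2 : c ≤ ε := (min_le_right _ _).trans (min_le_left _ _)
  have hc3 : c ≤ t⁻¹ - t'⁻¹ := (min_le_right _ _).trans (min_le_right _ _)
  have young : ∀ q > 0, ∀ A B : ℝ, 2 * (A * B) ≤ q * A ^ 2 + q⁻¹ * B ^ 2 := fun q hq A B => by
    have h1 : 0 ≤ q * (A - q⁻¹ * B) ^ 2 := by positivity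
    have h2 : q * (A - q⁻¹ * B) ^ 2 = q * A ^ 2 + q⁻¹ * B ^ 2 - 2 * (A * B) := by
      field_simp
      ring
    linarith
  have e1 : L⁻¹ * D ^ 2 ≤ i₁ := by
    rw [inv_mul_le_iff₀ hL]; exact h₁
  have e2 := young (2 * L'⁻¹) (by positivity) D X
  rw [mul_inv, inv_inv] at e2
  have e3 := young t' ht' Y V
  have e4 : t' * Y ^ 2 ≤ (t * N + ε) * X ^ 2 :=
    (mul_le_mul_of_nonneg_left h₄ ht'.le).trans (by
      rw [← mul_assoc]; exact mul_le_mul_of_nonneg_right htN (sq_nonneg X))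
  have e5 := (abs_le.1 h₂).1
  have e6 := (abs_le.1 h₃).2
  have f1 := mul_le_mul_of_nonneg_right hc1 (sq_nonneg D)
  have f2 := mul_le_mul_of_nonneg_right hc2 (sq_nonneg X)
  have f3 := mul_le_mul_of_nonneg_right hc3 (sq_nonneg V)
  have hr : r = L / 2 + t * N + 3 * ε := by rw [hε]; ring
  have e7 : (2 : ℝ)⁻¹ * L' * X ^ 2 = (L / 2 + ε) * X ^ 2 := by simp only [L']; ring
  rw [hr]
  linarith

theorem WithLp.prod_inner_eq {H K : Type*} [NormedAddCommGroup H] [InnerProductSpace ℝ H]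
    [NormedAddCommGroup K] [InnerProductSpace ℝ K] (a b : WithLp 2 (H × K)) :
    (inner ℝ a b : ℝ) = inner ℝ a.fst b.fst + inner ℝ a.snd b.snd := rfl

/-! ### The skew coupling and the primal-dual metric. -/

section PrimalDualOperators

variable {H K : Type*} [NormedAddCommGroup H] [InnerProductSpace ℝ H] [CompleteSpace H]
  [NormedAddCommGroup K] [InnerProductSpace ℝ K] [CompleteSpace K]

/-- The continuous linear map `(x, v) ↦ (A (x, v), A' (x, v))` into the Hilbert product. -/
noncomputable def toProdL2 (A : WithLp 2 (H × K) →L[ℝ] H) (A' : WithLp 2 (H × K) →L[ℝ] K) :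
    WithLp 2 (H × K) →L[ℝ] WithLp 2 (H × K) :=
  ((WithLp.prodContinuousLinearEquiv 2 ℝ H K).symm : H × K →L[ℝ] WithLp 2 (H × K)).comp (A.prod A')

/-- The skew-symmetric operator `(x, v) ↦ (T* v, -T x)`. -/
noncomputable def skewCoupling (T : H →L[ℝ] K) : WithLp 2 (H × K) →L[ℝ] WithLp 2 (H × K) :=
  toProdL2 ((ContinuousLinearMap.adjoint T).comp (WithLp.sndL 2 ℝ H K))
    (-(T.comp (WithLp.fstL 2 ℝ H K)))

/-- The preconditioner `(x, v) ↦ (r x - T* v, q v - T x)`. -/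
noncomputable def primalDualMetric (T : H →L[ℝ] K) (r q : ℝ) :
    WithLp 2 (H × K) →L[ℝ] WithLp 2 (H × K) :=
  toProdL2 (r • WithLp.fstL 2 ℝ H K
      - (ContinuousLinearMap.adjoint T).comp (WithLp.sndL 2 ℝ H K))
    (q • WithLp.sndL 2 ℝ H K - T.comp (WithLp.fstL 2 ℝ H K))

variable (T : H →L[ℝ] K) (r q : ℝ)

theorem skewCoupling_apply (w : WithLp 2 (H × K)) :
    skewCoupling T w = WithLp.toLp 2 (ContinuousLinearMap.adjoint T w.snd, -T w.fst) := rfl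

theorem primalDualMetric_apply (w : WithLp 2 (H × K)) :
    primalDualMetric T r q w = WithLp.toLp 2
      (r • w.fst - ContinuousLinearMap.adjoint T w.snd, q • w.snd - T w.fst) := rfl

theorem inner_skewCoupling_self (w : WithLp 2 (H × K)) :
    (inner ℝ (skewCoupling T w) w : ℝ) = 0 := by
  rw [skewCoupling_apply, WithLp.prod_inner_eq]
  simp only [WithLp.toLp_fst, WithLp.toLp_snd]
  rw [ContinuousLinearMap.adjoint_inner_left, inner_neg_left, real_inner_comm, add_neg_cancel]

theorem inner_primalDualMetric_comm (a b : WithLp 2 (H × K)) :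
    (inner ℝ (primalDualMetric T r q a) b : ℝ) = inner ℝ a (primalDualMetric T r q b) := by
  rw [primalDualMetric_apply, primalDualMetric_apply, WithLp.prod_inner_eq, WithLp.prod_inner_eq]
  simp only [WithLp.toLp_fst, WithLp.toLp_snd, inner_sub_left, inner_sub_right, inner_smul_left,
    inner_smul_right, ContinuousLinearMap.adjoint_inner_left,
    ContinuousLinearMap.adjoint_inner_right, conj_trivial]
  ring

theorem inner_primalDualMetric_self (a : WithLp 2 (H × K)) :
    (inner ℝ (primalDualMetric T r q a) a : ℝ)
      = r * ‖a.fst‖ ^ 2 - 2 * inner ℝ (T a.fst) a.snd + q * ‖a.snd‖ ^ 2 := by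
  rw [primalDualMetric_apply, WithLp.prod_inner_eq]
  simp only [WithLp.toLp_fst, WithLp.toLp_snd, inner_sub_left, inner_smul_left,
    ContinuousLinearMap.adjoint_inner_left, conj_trivial, real_inner_self_eq_norm_sq]
  rw [real_inner_comm (T a.fst)]
  ring

/-- The strict positivity that drives the Condat–Vũ iteration: the preconditioner dominates both
the coupling `T` and the cocoercive operator `A`. -/
theorem exists_primalDualMetric_slack {A : H → H} {L t N : ℝ} (hL : 0 < L) (ht : 0 < t)
    (hN : 0 ≤ N) (hr : L / 2 + t * N < r) (hT : ∀ x, ‖T x‖ ^ 2 ≤ N * ‖x‖ ^ 2)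
    (hA : ∀ x y, ‖A x - A y‖ ^ 2 ≤ L * inner ℝ (A x - A y) (x - y)) :
    ∃ c > 0, ∀ a b z : WithLp 2 (H × K),
      c * (‖b - a‖ ^ 2 + ‖(WithLp.toLp 2 (A a.fst, (0 : K)) - WithLp.toLp 2 (A z.fst, 0) :
          WithLp 2 (H × K))‖ ^ 2) ≤
        2 * inner ℝ (WithLp.toLp 2 (A a.fst, (0 : K)) - WithLp.toLp 2 (A z.fst, 0) :
          WithLp 2 (H × K)) (b - z)
        + inner ℝ (primalDualMetric T r t⁻¹ (b - a)) (b - a) := by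
  obtain ⟨c, hc, hmain⟩ := exists_pos_forall_le_coupled_quadratic hL ht hN hr
  refine ⟨c, hc, fun a b z => ?_⟩
  have h := hmain ‖A a.fst - A z.fst‖ ‖(b - a).fst‖ ‖(b - a).snd‖ ‖T (b - a).fst‖
    (inner ℝ (A a.fst - A z.fst) (a.fst - z.fst)) (inner ℝ (A a.fst - A z.fst) (b - a).fst)
    (inner ℝ (T (b - a).fst) (b - a).snd) (hA _ _) (abs_real_inner_le_norm _ _)
    (abs_real_inner_le_norm _ _) (hT _)
  rw [inner_primalDualMetric_self, WithLp.prod_inner_eq, WithLp.prod_norm_sq_eq_of_L2,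
    WithLp.prod_norm_sq_eq_of_L2]
  -- Splitting b - z at a isolates the term controlled by cocoercivity from the forward error,
  -- controlled by Cauchy–Schwarz.
  have e : a.fst - z.fst + (b - a).fst = (b - z).fst := by
    simp only [WithLp.sub_fst]; abel
  rw [← inner_add_right, e] at h
  simpa using h

end PrimalDualOperators

/-! ### The minimization problem and the convergence theorem. -/

section Problem

variable {H : Type*} [NormedAddCommGroup H] [InnerProductSpace ℝ H] [CompleteSpace H]
  {m : ℕ} {G : Fin m → Type*} [∀ i, NormedAddCommGroup (G i)]
  [∀ i, InnerProductSpace ℝ (G i)] [∀ i, CompleteSpace (G i)]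

/-- Adding the subgradient inequalities, the linear terms sum to zero by the inclusion. -/
theorem SatisfiesInclusion.isSolution {f : H → ℝ} {g : H → EReal} {h : ∀ i, G i → EReal}
    {B : ∀ i, H →L[ℝ] G i} (hf_convex : ConvexOn ℝ Set.univ f) (hf_diff : Differentiable ℝ f)
    (hg : IsGammaZero g) (hh : ∀ i, IsGammaZero (h i)) {x : H}
    (hx : SatisfiesInclusion f g h B x) : IsSolution f g h B x := by
  obtain ⟨a, ha, b, hb, hsum⟩ := hx
  refine ⟨EReal.add_ne_top (EReal.add_ne_top (EReal.coe_ne_top _) (hg.ne_top_of_mem_subdiff ha))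
    (EReal.finsetSum_ne_top fun i _ => (hh i).ne_top_of_mem_subdiff (hb i)), ?_⟩
  intro z _
  have h1 : (f x : EReal) + ((inner ℝ (gradient f x) (z - x) : ℝ) : EReal) ≤ f z := by
    exact_mod_cast hf_convex.inner_gradient_le hf_diff x z
  have h2 := add_le_add (add_le_add h1 (ha z))
    (Finset.sum_le_sum fun i (_ : i ∈ Finset.univ) => hb i (B i z))
  rw [Finset.sum_add_distrib, ← EReal.coe_finsetSum, add_add_add_comm (f x : EReal),
    add_add_add_comm, ← EReal.coe_add, ← EReal.coe_add] at h2
  have h3 : (inner ℝ (gradient f x) (z - x) : ℝ) + inner ℝ (z - x) a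
      + ∑ i, inner ℝ (B i z - B i x) (b i) = 0 := by
    have h4 : ∑ i, (inner ℝ (B i z - B i x) (b i) : ℝ)
        = inner ℝ (z - x) (∑ i, ContinuousLinearMap.adjoint (B i) (b i)) := by
      rw [inner_sum]
      refine Finset.sum_congr rfl fun i _ => ?_
      rw [ContinuousLinearMap.adjoint_inner_right, map_sub]
    rw [h4, real_inner_comm, ← inner_add_right, ← inner_add_right, hsum, inner_zero_right]
  rw [h3, EReal.coe_zero, add_zero] at h2
  exact h2

/-- The stacked operator `x ↦ (B i x) i` into the Hilbert sum. -/
noncomputable def stackedOperator (B : ∀ i, H →L[ℝ] G i) : H →L[ℝ] PiLp 2 G :=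
  ((PiLp.continuousLinearEquiv 2 ℝ G).symm : (∀ i, G i) →L[ℝ] PiLp 2 G).comp
    (ContinuousLinearMap.pi B)

variable (B : ∀ i, H →L[ℝ] G i)

theorem adjoint_stackedOperator_apply (v : PiLp 2 G) :
    ContinuousLinearMap.adjoint (stackedOperator B) v
      = ∑ i, ContinuousLinearMap.adjoint (B i) (v i) := by
  refine ext_inner_left ℝ fun x => ?_
  rw [ContinuousLinearMap.adjoint_inner_right, PiLp.inner_apply, inner_sum]
  exact Finset.sum_congr rfl fun i _ => (ContinuousLinearMap.adjoint_inner_right (B i) _ _).symm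

end Problem

theorem norm_stackedOperator_apply_sq_le {H : Type*} [NormedAddCommGroup H] [InnerProductSpace ℝ H]
    {m : ℕ} {G : Fin m → Type*} [∀ i, NormedAddCommGroup (G i)] [∀ i, InnerProductSpace ℝ (G i)]
    (B : ∀ i, H →L[ℝ] G i) (x : H) :
    ‖stackedOperator B x‖ ^ 2 ≤ (∑ i, ‖B i‖ ^ 2) * ‖x‖ ^ 2 := by
  rw [PiLp.norm_sq_eq_of_L2, Finset.sum_mul]
  refine Finset.sum_le_sum fun i _ => ?_
  rw [← mul_pow]
  exact pow_le_pow_left₀ (norm_nonneg _) ((B i).le_opNorm x) 2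

theorem theorem4p8
    {H : Type*} [NormedAddCommGroup H] [InnerProductSpace ℝ H] [CompleteSpace H]
    {m : ℕ} (hm : 1 ≤ m)
    {G : Fin m → Type*} [∀ i, NormedAddCommGroup (G i)] [∀ i, InnerProductSpace ℝ (G i)]
    [∀ i, CompleteSpace (G i)]
    (f : H → ℝ) (g : H → EReal) (h : ∀ i, G i → EReal) (B : ∀ i, H →L[ℝ] G i)
    (L : ℝ) (hL : 0 < L)
    (hf_convex : ConvexOn ℝ Set.univ f) (hf_diff : Differentiable ℝ f)
    (hf_lip : ∀ z w : H, ‖gradient f z - gradient f w‖ ≤ L * ‖z - w‖)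
    (hg : IsGammaZero g) (hh : ∀ i, IsGammaZero (h i))
    (hsolvable : ∃ z : H, SatisfiesInclusion f g h B z)
    (γ σ τ : ℝ) (hγ : γ ∈ Set.Ioo 0 (2 / L)) (hσ : 0 < σ) (hτ : 0 < τ)
    (hστ : σ * τ * ∑ i, ‖B i‖ ^ 2 < 1)
    (u xbar : ℕ → H) (y : ℕ → ∀ i, G i) (x : ℕ → H)
    (halg : IsPrimalDualFB f g h B γ σ τ u xbar y x)
    (hxbar0 : xbar 0 = x 0) (hxbar : ∀ k, 1 ≤ k → xbar k = x k) :
    ∃ xstar : H, IsSolution f g h B xstar ∧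
      Tendsto (fun k => toWeakSpace ℝ H (x k)) atTop (𝓝 (toWeakSpace ℝ H xstar)) := by
  have hγ0 : 0 < γ := hγ.1
  have hxb : ∀ k, xbar k = x k := fun k => by
    rcases k.eq_zero_or_pos with rfl | hk
    exacts [hxbar0, hxbar k hk]
  obtain ⟨z, a, ha, b, hb, hzero⟩ := hsolvable
  have hh' : ∀ i, IsGammaZero (fenchelConj (h i)) := fun i =>
    (hh i).fenchelConj ⟨b i, (hh i).fenchelConj_ne_top (hb i)⟩
  set T := stackedOperator B
  set r : ℝ := (1 + τ) / (τ * γ) with hr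
  set t : ℝ := σ / γ with ht
  have ht0 : 0 < t := div_pos hσ hγ0
  set N : ℝ := ∑ i, ‖B i‖ ^ 2 with hNdef
  have hN : 0 ≤ N := Finset.sum_nonneg fun i _ => sq_nonneg _
  -- After multiplication by τ γ this reads τ γ L / 2 + σ τ N < 1 + τ, the sum of the two step-size
  -- conditions.
  have hstrict : L / 2 + t * N < r := by
    have h1 : γ * L < 2 := (lt_div_iff₀ hL).1 hγ.2
    have h2 : τ * (γ * L) < τ * 2 := mul_lt_mul_of_pos_left h1 hτ
    rw [hr, ht, lt_div_iff₀ (mul_pos hτ hγ0)]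
    have h3 : (L / 2 + σ / γ * N) * (τ * γ) = τ * (γ * L) / 2 + σ * τ * N := by
      field_simp
    rw [h3]
    linarith
  obtain ⟨c, hc, hslack⟩ := exists_primalDualMetric_slack T r hL ht0 hN hstrict
    (norm_stackedOperator_apply_sq_le B) (hf_convex.gradient_cocoercive hL hf_diff hf_lip)
  let v : ℕ → PiLp 2 G := fun k => WithLp.toLp 2 fun i => (1 / γ) • y k i
  have hv : ∀ k i, y k i = γ • v k i := fun k i => by
    simp [v, smul_smul, hγ0.ne']
  let w : ℕ → WithLp 2 (H × PiLp 2 G) := fun k => WithLp.toLp 2 (x k, v k)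
  -- The off-diagonal parts of P and S combine: T* acts only on v k in the primal row, and B i acts
  -- on 2 x (k+1) - x k in the dual row, which is the extrapolation.
  have hstep : ∀ k, primalDualMetric T r t⁻¹ (w k - w (k + 1))
      - WithLp.toLp 2 (gradient f (w k).fst, 0) - skewCoupling T (w (k + 1))
      ∈ subdiff (separableSum g fun i => fenchelConj (h i)) (w (k + 1)) := by
    intro k
    refine mem_subdiff_separableSum ?_ fun i => ?_
    · have h1 := (halg.primal_step k).smul_sub_mem_subdiff hg (by positivity)
      rw [hxb, hxb, halg.forward_step] at h1
      refine Eq.subst (motive := (· ∈ subdiff g (x (k + 1)))) (Eq.symm ?_) h1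
      have h2 : ∑ i, ContinuousLinearMap.adjoint (B i) (y k i)
          = γ • ContinuousLinearMap.adjoint T (v k) := by
        rw [adjoint_stackedOperator_apply, Finset.smul_sum]
        exact Finset.sum_congr rfl fun i _ => by rw [hv, map_smul]
      rw [h2]
      change r • (x k - x (k + 1)) - ContinuousLinearMap.adjoint T (v k - v (k + 1))
        - gradient f (x k) - ContinuousLinearMap.adjoint T (v (k + 1)) = _
      rw [map_sub, hr]
      have : 1 + τ ≠ 0 := by positivity
      match_scalars <;> field_simp <;> ring
    · obtain ⟨p, hp, hyp⟩ := halg.dual_step k i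
      have hpv : p = v (k + 1) i := by
        simp [v, hyp, smul_smul, hγ0.ne']
      have h1 := hp.smul_sub_mem_subdiff (hh' i) (div_pos hσ hγ0)
      rw [hpv, hxb, hxb, hv] at h1
      refine Eq.subst (motive := (· ∈ subdiff (fenchelConj (h i)) (v (k + 1) i))) (Eq.symm ?_) h1
      change t⁻¹ • (v k i - v (k + 1) i) - B i (x k - x (k + 1)) - 0 - -B i (x (k + 1)) = _
      rw [map_sub, map_sub, map_smul, ht]
      match_scalars <;> field_simp <;> ring
  obtain ⟨wstar, hstar, hlim⟩ := forwardBackward_weakTendsto (hg.separableSum hh')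
    (inner_skewCoupling_self T) (inner_primalDualMetric_comm T r t⁻¹) hc hslack hstep
    ⟨WithLp.toLp 2 (z, WithLp.toLp 2 b), by
      refine mem_subdiff_separableSum ?_ fun i => ?_
      · refine Eq.subst (motive := (· ∈ subdiff g z)) (Eq.symm ?_) ha
        change -gradient f z - ContinuousLinearMap.adjoint T (WithLp.toLp 2 b) = a
        rw [adjoint_stackedOperator_apply, sub_eq_iff_eq_add, neg_eq_iff_add_eq_zero, ← add_assoc]
        exact hzero
      · refine Eq.subst (motive := (· ∈ subdiff (fenchelConj (h i)) (b i))) (Eq.symm ?_)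
          ((hh i).mem_subdiff_fenchelConj (hb i))
        change -(0 : G i) - -B i z = B i z
        simp⟩
  refine ⟨wstar.fst, SatisfiesInclusion.isSolution hf_convex hf_diff hg hh
    ⟨_, subdiff_fst_of_separableSum hg hh' hstar, fun i => wstar.snd i, fun i => ?_, ?_⟩, ?_⟩
  -- The dual limit supplies the subgradients of the h i, once the conjugate inclusion is inverted.
  · have h1 := subdiff_snd_of_separableSum hg hh' hstar i
    have h2 := (hh' i).ne_top_of_mem_subdiff h1
    refine (hh i).mem_subdiff_of_fenchelConj ?_ h2
    convert h1 using 1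
    change B i wstar.fst = -(0 : G i) - -B i wstar.fst
    simp
  · rw [← adjoint_stackedOperator_apply]
    change gradient f wstar.fst + (-gradient f wstar.fst
      - ContinuousLinearMap.adjoint T wstar.snd) + ContinuousLinearMap.adjoint T wstar.snd = 0
    abel
  · refine (WeakBilin.tendsto_iff_forall_eval_tendsto _ ?_).2 fun φ => ?_
    · exact fun a b hab => ext_inner_left ℝ fun q => LinearMap.congr_fun hab (innerSL ℝ q)
    -- Testing against vectors with zero dual part extracts weak convergence of x k.
    · have h1 := hlim (WithLp.toLp 2 ((InnerProductSpace.toDual ℝ H).symm φ, 0))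
      have h2 : ∀ q : WithLp 2 (H × PiLp 2 G), (inner ℝ q
          (WithLp.toLp 2 ((InnerProductSpace.toDual ℝ H).symm φ, (0 : PiLp 2 G))) : ℝ)
          = φ q.fst := fun q => by
        rw [WithLp.prod_inner_eq]
        simp only [WithLp.toLp_fst, WithLp.toLp_snd, inner_zero_right, add_zero]
        rw [real_inner_comm, InnerProductSpace.toDual_symm_apply]
      simp only [h2] at h1
      exact h1
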